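/- Let $K$ be a field, let $m,n,r\ge 1$, and let $X_k=(x_{ij}^k)_{1\le i\le m,\,1\le j\le n}$ for $1\le k\le r$ be matrices of distinct indeterminates. Put $S=K[x_{ij}^k]$, let $H=(X_1\mid\cdots\mid X_r)$ be the horizontal concatenation and $V$ the vertical concatenation (top to bottom) of $X_1,\dots,X_r$, and let $I_{mn}^r\subseteq S$ be the ideal generated by the $2$-minors of $H$ and of $V$. Fix a monomial order on $S$ that is diagonal: the leading term of every $2$-minor of $H$ and of $V$ is the product of the entries on its main diagonal. There is a unique simplicial complex $\Delta$ on the vertex set $\{x_{ij}^k\}$ whose Stanley-Reisner ideal $I_\Delta$ is the initial ideal $\operatorname{in}(I_{mn}^r)$. Identify $x_{ij}^k$ with the point $(i,(k-1)n+j)$ of $\{1,\dots,m\}\times\{1,\dots,nr\}$. A path $a\longrightarrow b$ is a sequence of points that starts at $a$, ends at $b$ (possibly $a=b$), and whose consecutive differences lie in $\{(-1,0),(0,1)\}$; its word is obtained by writing $M$ for each step $(-1,0)$ and $N$ for each step $(0,1)$. Then there is a bijection $e$ from the set $\mathcal F(\Delta)$ of facets of $\Delta$ onto the set of words on the multiset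 $\{M^{m-1},N^{n-1},R^{r-1}\}$ such that, for every facet $F$ and every such word $w$, one has $e(F)=w$ if and only if the following holds: there are integers $m=g_0\ge g_1\ge\cdots\ge g_r=1$ and $n=h_0\ge h_1\ge\cdots\ge h_r=1$ and paths $$(g_{k-1},(k-1)n+h_k)\longrightarrow(g_k,(k-1)n+h_{k-1}),\qquad 1\le k\le r,$$ with words $w_1,\dots,w_r$, such that $F$ is the union of (the point sets of) these $r$ paths and $w=w_1Rw_2R\cdots Rw_r$. -/

import Mathlib

namespace DoubleDet

/-- The indices of the variables `x_{ij}^k`, as triples `(i, j, k)` (numbered from `0`). -/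
abbrev Var (m n r : ℕ) : Type := Fin m × Fin n × Fin r

section Ideals

variable (K : Type*) [Field K] (m n r : ℕ)

/-- The horizontal concatenation `H = (X_1 | ... | X_r)` of the generic `m × n` matrices `X_k`.
The columns are indexed by the pairs `(k, j)`, in lexicographic order. -/
noncomputable def horizontal :
    Matrix (Fin m) (Fin r ×ₗ Fin n) (MvPolynomial (Var m n r) K) :=
  Matrix.of fun i c => MvPolynomial.X (i, (ofLex c).2, (ofLex c).1)

/-- The vertical concatenation `V` of `X_1, ..., X_r` (from top to bottom).
The rows are indexed by the pairs `(k, i)`, in lexicographic order. -/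
noncomputable def vertical :
    Matrix (Fin r ×ₗ Fin m) (Fin n) (MvPolynomial (Var m n r) K) :=
  Matrix.of fun c j => MvPolynomial.X ((ofLex c).2, j, (ofLex c).1)

/-- The set of the `2`-minors of a matrix. -/
def twoMinors {ρ γ S : Type*} [Preorder ρ] [Preorder γ] [CommRing S] (A : Matrix ρ γ S) : Set S :=
  {d | ∃ (f : Fin 2 ↪o ρ) (g : Fin 2 ↪o γ), d = (A.submatrix f g).det}

/-- The toric double determinantal ideal `I_{mn}^r`, generated by the `2`-minors of `H` and `V`. -/
noncomputable def doubleDetIdeal : Ideal (MvPolynomial (Var m n r) K) :=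
  Ideal.span (twoMinors (horizontal K m n r) ∪ twoMinors (vertical K m n r))

variable {m n r}

/-- The leading term of every `2`-minor of `A` is the product of its main diagonal. -/
def DiagonalFor (ord : MonomialOrder (Var m n r)) {ρ γ : Type*} [Preorder ρ] [Preorder γ]
    (A : Matrix ρ γ (MvPolynomial (Var m n r) K)) : Prop :=
  ∀ (f : Fin 2 ↪o ρ) (g : Fin 2 ↪o γ),
    ord.leadingTerm (A.submatrix f g).det = A (f 0) (g 0) * A (f 1) (g 1)

/-- Diagonal term orders. -/
def IsDiagonal (ord : MonomialOrder (Var m n r)) : Prop :=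
  DiagonalFor K ord (horizontal K m n r) ∧ DiagonalFor K ord (vertical K m n r)

variable {K}

/-- The initial ideal of `I`: the ideal generated by the leading terms of the elements of `I`. -/
noncomputable def initialIdeal {σ : Type*} (ord : MonomialOrder σ) (I : Ideal (MvPolynomial σ K)) :
    Ideal (MvPolynomial σ K) :=
  Ideal.span (ord.leadingTerm '' (I : Set (MvPolynomial σ K)))

variable (K)

/-- The Stanley-Reisner ideal `I_Δ`, generated by the squarefree monomials of the non-faces of `Δ`.
(The faces of Mathlib's complexes are nonempty by convention; the empty set counts as a face
here, so only nonempty non-faces contribute.) -/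
noncomputable def stanleyReisnerIdeal {σ : Type*} (Δ : AbstractSimplicialComplex σ) :
    Ideal (MvPolynomial σ K) :=
  Ideal.span {p | ∃ F : Finset σ, F.Nonempty ∧ F ∉ Δ ∧ p = ∏ v ∈ F, MvPolynomial.X v}

end Ideals

/-- The facets (maximal faces) of a simplicial complex. -/
def Facets {σ : Type*} (Δ : AbstractSimplicialComplex σ) : Type _ :=
  {F : Finset σ // Maximal (fun G => G ∈ Δ) F}

/-- The letters `M`, `N`, `R`. -/
inductive Letter : Type
  | M
  | N
  | R
  deriving DecidableEq

/-- The words on the multiset `{M^{m-1}, N^{n-1}, R^{r-1}}`. -/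
def Words (m n r : ℕ) : Type :=
  {w : List Letter //
    w.count Letter.M = m - 1 ∧ w.count Letter.N = n - 1 ∧ w.count Letter.R = r - 1}

/-- The point `(i, (k-1)n + j)` of the grid `{1, ..., m} × {1, ..., nr}` that corresponds to the
variable `x_{ij}^k` with `1 ≤ i ≤ m`, `1 ≤ j ≤ n`, `1 ≤ k ≤ r` (the components of `v` are
`i - 1`, `j - 1`, `k - 1`). -/
def gridPoint {m n r : ℕ} (v : Var m n r) : ℤ × ℤ :=
  ((v.1 : ℤ) + 1, (v.2.2 : ℤ) * n + ((v.2.1 : ℤ) + 1))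

/-- `l` lists the points of a path `a ⟶ b`: each step is `(-1, 0)` or `(0, 1)`. -/
def IsPath (l : List (ℤ × ℤ)) (a b : ℤ × ℤ) : Prop :=
  l.head? = some a ∧ l.getLast? = some b ∧
    l.IsChain fun p q => q - p = (-1, 0) ∨ q - p = (0, 1)

/-- The word of a path: a step `(0, 1)` is encoded by `N`, a step `(-1, 0)` by `M`. -/
def pathWord : List (ℤ × ℤ) → List Letter
  | p :: q :: l => (if q - p = (0, 1) then Letter.N else Letter.M) :: pathWord (q :: l)
  | _ => []

/-- `F` is the union of `r` paths
`(g_{k-1}, (k-1)n + h_k) ⟶ (g_k, (k-1)n + h_{k-1})`, `1 ≤ k ≤ r`, for some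
`m = g_0 ≥ g_1 ≥ ... ≥ g_r = 1` and `n = h_0 ≥ h_1 ≥ ... ≥ h_r = 1`, and `w` is
`w_1 R w_2 R ... R w_r`, where `w_k` is the word of the `k`-th path.
(Here the path number `k` is indexed by `k - 1 : Fin r`.) -/
def Encodes {m n r : ℕ} (F : Finset (Var m n r)) (w : List Letter) : Prop :=
  ∃ (g h : Fin (r + 1) → ℤ) (p : Fin r → List (ℤ × ℤ)),
    (Antitone g ∧ g 0 = m ∧ g (Fin.last r) = 1) ∧
    (Antitone h ∧ h 0 = n ∧ h (Fin.last r) = 1) ∧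
    (∀ k : Fin r, IsPath (p k)
      (g k.castSucc, (k : ℤ) * n + h k.succ) (g k.succ, (k : ℤ) * n + h k.castSucc)) ∧
    gridPoint '' (F : Set (Var m n r)) = {q | ∃ k, q ∈ p k} ∧
    w = [Letter.R].intercalate (List.ofFn fun k => pathWord (p k))

end DoubleDet

namespace DoubleDet

open MvPolynomial

/-! The two terms of a 2-minor of H or V have the same multisets of row, column and block indices. A
standard monomial, one divisible by no main diagonal, is determined by these three multisets
(`eq_of_isStandard`). Replacing a diagonal by the other term of its minor lowers a monomial within
its multidegree, so a standard monomial is the least of its multidegree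
(`IsStandard.le_of_multidegree_eq`). In an element of the ideal the coefficients in each multidegree
sum to zero, so no leading monomial is standard. Hence the diagonals generate the initial ideal, and
`Δ` is the complex of diagonal-free sets; it is unique because a Stanley-Reisner ideal remembers the
non-faces.

A set is diagonal-free when no two points of one block increase strictly in both coordinates, and
neither the row nor the column index increases on passing to a later block. Such a set fits into a
descending staircase of rectangles with corners given by `g` and `h`, and in each rectangle it lies
on a path. Conversely, every union of such paths is diagonal-free and has `r + (m - 1) + (n - 1)`
points, so these unions are exactly the facets (`maximal_iff_exists_encodes`). The facet recovers
its paths block by block; the word recovers them because the numbers of `M` and `N` between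
consecutive `R`s fix the corners. -/

variable {m n r : ℕ}

/-! ### Diagonals, standard sets and the multidegree -/

/-- The order embedding of `Fin 2` with values `a < b`. -/
def pairEmbedding {α : Type*} [Preorder α] {a b : α} (h : a < b) : Fin 2 ↪o α :=
  OrderEmbedding.ofStrictMono ![a, b] (by
    intro i j hij
    fin_cases i <;> fin_cases j <;> simp_all)

@[simp] theorem pairEmbedding_zero {α : Type*} [Preorder α] {a b : α} (h : a < b) :
    pairEmbedding h 0 = a := rfl

@[simp] theorem pairEmbedding_one {α : Type*} [Preorder α] {a b : α} (h : a < b) :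
    pairEmbedding h 1 = b := rfl

/-- The product of the variables `v` and `w` is the main diagonal of a `2`-minor of the horizontal
or of the vertical concatenation. -/
def IsDiag (v w : Var m n r) : Prop :=
  (v.1 < w.1 ∧ (v.2.2 < w.2.2 ∨ v.2.2 = w.2.2 ∧ v.2.1 < w.2.1)) ∨
    (v.2.1 < w.2.1 ∧ (v.2.2 < w.2.2 ∨ v.2.2 = w.2.2 ∧ v.1 < w.1))

/-- The set contains no main diagonal. -/
def IsStandard (s : Set (Var m n r)) : Prop :=
  ∀ v ∈ s, ∀ w ∈ s, ¬ IsDiag v w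

theorem IsStandard.mono {s t : Set (Var m n r)} (h : IsStandard t) (hst : s ⊆ t) :
    IsStandard s :=
  fun v hv w hw => h v (hst hv) w (hst hw)

theorem not_isDiag_self (v : Var m n r) : ¬ IsDiag v v := by
  simp [IsDiag]

/-- The multidegree of a monomial for the grading by row, column and block indices. -/
noncomputable def multidegree :
    (Var m n r →₀ ℕ) →+ Multiset (Fin m) × Multiset (Fin n) × Multiset (Fin r) :=
  ((Multiset.mapAddMonoidHom (fun v : Var m n r => v.1)).prod
    ((Multiset.mapAddMonoidHom (fun v : Var m n r => v.2.1)).prod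
      (Multiset.mapAddMonoidHom (fun v : Var m n r => v.2.2)))).comp
    Finsupp.toMultiset

theorem multidegree_apply (t : Var m n r →₀ ℕ) :
    multidegree t = ((Finsupp.toMultiset t).map (fun v => v.1),
      (Finsupp.toMultiset t).map (fun v => v.2.1), (Finsupp.toMultiset t).map (fun v => v.2.2)) :=
  rfl

theorem multidegree_single_add_single (v w : Var m n r) :
    multidegree (Finsupp.single v 1 + Finsupp.single w 1) =
      ({v.1, w.1}, {v.2.1, w.2.1}, {v.2.2, w.2.2}) := by
  simp [multidegree_apply, Finsupp.toMultiset_single]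

/-! ### Minors under a diagonal monomial order -/

section Algebra

variable {K : Type*} [Field K]

theorem X_mul_X_eq_monomial {σ : Type*} (v w : σ) :
    (X v * X w : MvPolynomial σ K) = monomial (Finsupp.single v 1 + Finsupp.single w 1) 1 := by
  simp [X, monomial_mul]

theorem det_submatrix_horizontal {a b : Fin m} {c d : Fin r ×ₗ Fin n} (h : a < b) (h' : c < d) :
    ((horizontal K m n r).submatrix (pairEmbedding h) (pairEmbedding h')).det =
      X (a, (ofLex c).2, (ofLex c).1) * X (b, (ofLex d).2, (ofLex d).1) -
        X (a, (ofLex d).2, (ofLex d).1) * X (b, (ofLex c).2, (ofLex c).1) := by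
  simp [Matrix.det_fin_two, horizontal]

theorem det_submatrix_vertical {a b : Fin n} {c d : Fin r ×ₗ Fin m} (h : a < b) (h' : c < d) :
    ((vertical K m n r).submatrix (pairEmbedding h') (pairEmbedding h)).det =
      X ((ofLex c).2, a, (ofLex c).1) * X ((ofLex d).2, b, (ofLex d).1) -
        X ((ofLex c).2, b, (ofLex c).1) * X ((ofLex d).2, a, (ofLex d).1) := by
  simp [Matrix.det_fin_two, vertical]

/-- `v'` and `w'` form the antidiagonal of the minor. The final inequalities ensure that its two
monomials differ. -/
theorem IsDiag.exists_minor {ord : MonomialOrder (Var m n r)} (hord : IsDiagonal K ord)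
    {v w : Var m n r} (h : IsDiag v w) :
    ∃ v' w' : Var m n r,
      (X v * X w - X v' * X w' : MvPolynomial (Var m n r) K) ∈ doubleDetIdeal K m n r ∧
      ord.leadingTerm (X v * X w - X v' * X w' : MvPolynomial (Var m n r) K) = X v * X w ∧
      multidegree (Finsupp.single v' 1 + Finsupp.single w' 1) =
        multidegree (Finsupp.single v 1 + Finsupp.single w 1) ∧
      v ≠ v' ∧ v ≠ w' := by
  obtain ⟨i, j, k⟩ := v
  obtain ⟨i', j', k'⟩ := w
  simp only [IsDiag] at h
  obtain ⟨hi, hc⟩ | ⟨hj, hc⟩ := h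
  · have hlt : toLex (k, j) < toLex (k', j') := Prod.Lex.toLex_lt_toLex.2 hc
    have hdet := det_submatrix_horizontal (K := K) hi hlt
    have hlt' := hord.1 (pairEmbedding hi) (pairEmbedding hlt)
    -- A column of H is a pair (block, column), so both indices are exchanged.
    refine ⟨(i, j', k'), (i', j, k), ?_, ?_, ?_, ?_, ?_⟩
    · exact Ideal.subset_span (Or.inl ⟨_, _, hdet.symm⟩)
    · rw [hdet] at hlt'
      exact hlt'
    · simp only [multidegree_single_add_single]
      rw [Multiset.pair_comm j, Multiset.pair_comm k]
    · rintro ⟨⟩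
      simp at hc
    · simp [hi.ne]
  · have hlt : toLex (k, i) < toLex (k', i') := Prod.Lex.toLex_lt_toLex.2 hc
    have hdet := det_submatrix_vertical (K := K) hj hlt
    have hlt' := hord.2 (pairEmbedding hlt) (pairEmbedding hj)
    -- A row of V carries the block index, so only the column indices are exchanged.
    refine ⟨(i, j', k), (i', j, k'), ?_, ?_, ?_, ?_, ?_⟩
    · exact Ideal.subset_span (Or.inr ⟨_, _, hdet.symm⟩)
    · rw [hdet] at hlt'
      exact hlt'
    · simp only [multidegree_single_add_single]
      rw [Multiset.pair_comm j]
    · simp [hj.ne]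
    · rintro ⟨⟩
      simp at hc

theorem degree_lt_of_leadingTerm_sub {σ : Type*} (ord : MonomialOrder σ) {a b : σ →₀ ℕ}
    (hab : a ≠ b)
    (h : ord.leadingTerm (monomial a (1 : K) - monomial b 1) = monomial a 1) :
    ord.toSyn b < ord.toSyn a := by
  classical
  set f : MvPolynomial σ K := monomial a (1 : K) - monomial b 1 with hf
  have hfa : f.coeff a = 1 := by simp [hf, coeff_monomial, hab.symm]
  have hfb : f.coeff b = -1 := by simp [hf, coeff_monomial, hab]
  have hdeg : ord.degree f = a := by
    have h0 : f ≠ 0 := by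
      rintro h0
      simp [h0] at hfa
    rw [MonomialOrder.leadingTerm, monomial_eq_monomial_iff] at h
    exact (by simpa using h : ord.degree f = a ∧ _).1
  refine lt_of_le_of_ne ?_ fun h => hab (ord.toSyn.injective h).symm
  rw [← hdeg]
  exact ord.le_degree (by simp [mem_support_iff, hfb])

theorem IsDiag.exists_lt {ord : MonomialOrder (Var m n r)} (hord : IsDiagonal K ord)
    {v w : Var m n r} (h : IsDiag v w) :
    ∃ b : Var m n r →₀ ℕ,
      ord.toSyn b < ord.toSyn (Finsupp.single v 1 + Finsupp.single w 1) ∧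
      multidegree b = multidegree (Finsupp.single v 1 + Finsupp.single w 1) := by
  obtain ⟨v', w', -, hlt, hdeg, hv, hw⟩ := h.exists_minor hord
  refine ⟨_, degree_lt_of_leadingTerm_sub (K := K) ord ?_ ?_, hdeg⟩
  · intro heq
    have := DFunLike.congr_fun heq v
    simp [Finsupp.single_apply, hv.symm, hw.symm] at this
  · simpa only [X_mul_X_eq_monomial] using hlt

theorem IsDiag.X_mul_X_mem_initialIdeal {ord : MonomialOrder (Var m n r)}
    (hord : IsDiagonal K ord) {v w : Var m n r} (h : IsDiag v w) :
    (X v * X w : MvPolynomial (Var m n r) K) ∈ initialIdeal ord (doubleDetIdeal K m n r) := by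
  obtain ⟨v', w', hmem, hlt, -⟩ := h.exists_minor hord
  exact Ideal.subset_span ⟨_, hmem, hlt⟩

end Algebra

/-! ### Standard multisets are determined by their multidegree -/

theorem IsStandard.fst_le {s : Set (Var m n r)} (hs : IsStandard s) {v w : Var m n r}
    (hv : v ∈ s) (hw : w ∈ s) (h : v.2.2 < w.2.2) : w.1 ≤ v.1 := by
  by_contra! h'
  exact hs v hv w hw (Or.inl ⟨h', Or.inl h⟩)

theorem IsStandard.snd_le {s : Set (Var m n r)} (hs : IsStandard s) {v w : Var m n r}
    (hv : v ∈ s) (hw : w ∈ s) (h : v.2.2 < w.2.2) : w.2.1 ≤ v.2.1 := by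
  by_contra! h'
  exact hs v hv w hw (Or.inr ⟨h', Or.inl h⟩)

theorem IsStandard.fst_le_of_snd_lt {s : Set (Var m n r)} (hs : IsStandard s) {v w : Var m n r}
    (hv : v ∈ s) (hw : w ∈ s) (h : v.2.2 = w.2.2) (h' : v.2.1 < w.2.1) : w.1 ≤ v.1 := by
  by_contra! h''
  exact hs v hv w hw (Or.inl ⟨h'', Or.inr ⟨h, h'⟩⟩)

/-- A nonempty standard multiset has an element with the least block index, the largest row index
and the least column index inside its block. -/
theorem exists_first {T : Multiset (Var m n r)} (hT : IsStandard {v | v ∈ T}) (h0 : T ≠ 0) :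
    ∃ v ∈ T, (∀ w ∈ T, v.2.2 ≤ w.2.2) ∧ (∀ w ∈ T, w.1 ≤ v.1) ∧
      ∀ w ∈ T, w.2.2 = v.2.2 → v.2.1 ≤ w.2.1 := by
  classical
  -- The minimum is by block, then column, then decreasing row. Standardness forbids larger rows in
  -- later columns or blocks.
  obtain ⟨v, hv, hmin⟩ := Finset.exists_min_image T.toFinset
    (fun v => toLex (v.2.2, toLex (v.2.1, OrderDual.toDual v.1)))
    (by simpa [Finset.nonempty_iff_ne_empty] using h0)
  simp only [Multiset.mem_toFinset, Prod.Lex.toLex_le_toLex, OrderDual.toDual_le_toDual] at hv hmin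
  refine ⟨v, hv, fun w hw => ?_, fun w hw => ?_, fun w hw h => ?_⟩
  · rcases hmin w hw with h | h
    · exact h.le
    · exact h.1.le
  · rcases hmin w hw with h | ⟨h, h' | h'⟩
    · exact hT.fst_le hv hw h
    · exact hT.fst_le_of_snd_lt hv hw h h'
    · exact h'.2
  · rcases hmin w hw with h' | ⟨-, h' | h'⟩
    · exact absurd h h'.ne'
    · exact h'.le
    · exact h'.1.le

theorem countP_eq_of_map_eq {α β : Type*} {f : α → β} {T S : Multiset α}
    (h : T.map f = S.map f) (p : β → Prop) [DecidablePred p] :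
    T.countP (fun a => p (f a)) = S.countP (fun a => p (f a)) := by
  have := congrArg (Multiset.countP p) h
  simpa only [Multiset.countP_map, ← Multiset.countP_eq_card_filter] using this

theorem countP_le_countP {α : Type*} {T : Multiset α} {p q : α → Prop} [DecidablePred p]
    [DecidablePred q] (h : ∀ a ∈ T, p a → q a) : T.countP p ≤ T.countP q := by
  induction T using Multiset.induction_on with
  | empty => simp
  | cons a T ih =>
    have := ih fun b hb => h b (Multiset.mem_cons_of_mem hb)
    have := h a (Multiset.mem_cons_self a T)
    simp only [Multiset.countP_cons]
    split_ifs <;> first | omega | (exfalso; tauto)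

theorem countP_lt_countP {α : Type*} [DecidableEq α] {T : Multiset α} {p q : α → Prop}
    [DecidablePred p] [DecidablePred q] (h : ∀ a ∈ T, p a → q a) {a : α} (ha : a ∈ T)
    (hp : ¬ p a) (hq : q a) : T.countP p < T.countP q := by
  obtain ⟨T, rfl⟩ := Multiset.exists_cons_of_mem ha
  have := countP_le_countP (T := T) (p := p) (q := q)
    fun b hb => h b (Multiset.mem_cons_of_mem hb)
  simp only [Multiset.countP_cons, hp, hq, if_true, if_false]
  omega

/-- Double counting in the first block. If `v` lay left of `w`, then in `T` every element with
column at least that of `w` would be in the first block, since later blocks have columns at most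
that of `v`; and `v` itself would be missed. In `S` all elements of the first block have such a
column. The two counts agree for `T` and `S`, a contradiction. -/
theorem not_first_lt {T S : Multiset (Var m n r)} (hT : IsStandard {v | v ∈ T})
    (h₂ : T.map (fun v => v.2.1) = S.map (fun v => v.2.1))
    (h₃ : T.map (fun v => v.2.2) = S.map (fun v => v.2.2)) {v w : Var m n r} (hv : v ∈ T)
    (hvmin : ∀ u ∈ T, v.2.2 ≤ u.2.2) (hwmin : ∀ u ∈ S, u.2.2 = w.2.2 → w.2.1 ≤ u.2.1)
    (hvw : v.2.2 = w.2.2) : ¬ v.2.1 < w.2.1 := by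
  classical
  intro hlt
  have e₂ := countP_eq_of_map_eq h₂ (fun j => w.2.1 ≤ j)
  have e₃ := countP_eq_of_map_eq h₃ (fun k => k = w.2.2)
  have l₁ : S.countP (fun u => u.2.2 = w.2.2) ≤ S.countP (fun u => w.2.1 ≤ u.2.1) :=
    countP_le_countP hwmin
  have l₂ : T.countP (fun u => w.2.1 ≤ u.2.1) < T.countP (fun u => u.2.2 = w.2.2) := by
    refine countP_lt_countP (fun u hu huw => ?_) hv (not_le.2 hlt) hvw
    by_contra hne
    rw [← hvw] at hne
    have := hT.snd_le hv hu (lt_of_le_of_ne (hvmin u hu) (Ne.symm hne))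
    exact absurd (hlt.trans_le huw) (not_lt.2 this)
  omega

/-- A standard multiset is determined by the multisets of its row, column and block indices. -/
theorem eq_of_isStandard (T S : Multiset (Var m n r)) (hT : IsStandard {v | v ∈ T})
    (hS : IsStandard {v | v ∈ S})
    (h₁ : T.map (fun v => v.1) = S.map (fun v => v.1))
    (h₂ : T.map (fun v => v.2.1) = S.map (fun v => v.2.1))
    (h₃ : T.map (fun v => v.2.2) = S.map (fun v => v.2.2)) : T = S := by
  induction hd : T.card generalizing T S with
  | zero =>
    have hT0 := Multiset.card_eq_zero.1 hd
    subst hT0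
    exact (Multiset.map_eq_zero.1 h₁.symm).symm
  | succ d ih =>
    have hT0 : T ≠ 0 := by
      rintro rfl
      simp at hd
    have hS0 : S ≠ 0 := by
      rintro rfl
      simp [hT0] at h₁
    obtain ⟨v, hv, hv₃, hv₁, hv₂⟩ := exists_first hT hT0
    obtain ⟨w, hw, hw₃, hw₁, hw₂⟩ := exists_first hS hS0
    have key {β : Type} {f : Var m n r → β} {T S : Multiset (Var m n r)}
        (h : T.map f = S.map f) {v} (hv : v ∈ T) : ∃ u ∈ S, f u = f v := by
      rw [← Multiset.mem_map, ← h]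
      exact Multiset.mem_map_of_mem f hv
    have e₁ : v.1 = w.1 := by
      obtain ⟨u, hu, hu'⟩ := key h₁ hv
      obtain ⟨u₂, hu₂, hu₂'⟩ := key h₁.symm hw
      exact le_antisymm (hu' ▸ hw₁ u hu) (hu₂' ▸ hv₁ u₂ hu₂)
    have e₃ : v.2.2 = w.2.2 := by
      obtain ⟨u, hu, hu'⟩ := key h₃ hv
      obtain ⟨u₂, hu₂, hu₂'⟩ := key h₃.symm hw
      exact le_antisymm (hu₂' ▸ hv₃ u₂ hu₂) (hu' ▸ hw₃ u hu)
    have e₂ : v.2.1 = w.2.1 :=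
      le_antisymm (not_lt.1 (not_first_lt hS h₂.symm h₃.symm hw hw₃ hv₂ e₃.symm))
        (not_lt.1 (not_first_lt hT h₂ h₃ hv hv₃ hw₂ e₃))
    -- The first elements coincide; cancel them and induct on the cardinality.
    obtain rfl : v = w := Prod.ext e₁ (Prod.ext e₂ e₃)
    obtain ⟨T, rfl⟩ := Multiset.exists_cons_of_mem hv
    obtain ⟨S, rfl⟩ := Multiset.exists_cons_of_mem hw
    simp only [Multiset.map_cons, Multiset.cons_inj_right] at h₁ h₂ h₃
    rw [ih T S (hT.mono fun u hu => Multiset.mem_cons_of_mem hu)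
      (hS.mono fun u hu => Multiset.mem_cons_of_mem hu) h₁ h₂ h₃ (by simpa using hd)]

theorem eq_of_multidegree_eq {s t : Var m n r →₀ ℕ} (hs : IsStandard (s.support : Set (Var m n r)))
    (ht : IsStandard (t.support : Set (Var m n r))) (h : multidegree s = multidegree t) :
    s = t := by
  classical
  simp only [multidegree_apply, Prod.mk.injEq] at h
  rw [← Finsupp.toMultiset_toFinsupp s, ← Finsupp.toMultiset_toFinsupp t,
    eq_of_isStandard _ _ (hs.mono fun v hv => by simpa using hv)
      (ht.mono fun v hv => by simpa using hv) h.1 h.2.1 h.2.2]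

/-! ### Standard monomials and leading terms -/

section Algebra

variable {K : Type*} [Field K]

variable (m n r K) in
/-- The coefficient sums of a polynomial over the monomials of each multidegree. -/
noncomputable def multidegreeHom : MvPolynomial (Var m n r) K →+*
    AddMonoidAlgebra K (Multiset (Fin m) × Multiset (Fin n) × Multiset (Fin r)) :=
  AddMonoidAlgebra.mapDomainRingHom K multidegree

theorem multidegreeHom_monomial (t : Var m n r →₀ ℕ) (c : K) :
    multidegreeHom m n r K (monomial t c) = AddMonoidAlgebra.single (multidegree t) c :=
  AddMonoidAlgebra.mapDomain_single

theorem doubleDetIdeal_le_ker : doubleDetIdeal K m n r ≤ RingHom.ker (multidegreeHom m n r K) := by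
  refine Ideal.span_le.2 ?_
  rintro d (⟨f, g, rfl⟩ | ⟨f, g, rfl⟩)
  · simp only [horizontal, Matrix.det_fin_two, Matrix.submatrix_apply, Matrix.of_apply,
      SetLike.mem_coe, RingHom.mem_ker, map_sub, X_mul_X_eq_monomial, multidegreeHom_monomial,
      multidegree_single_add_single]
    rw [Multiset.pair_comm (ofLex (g 0)).2, Multiset.pair_comm (ofLex (g 0)).1, sub_self]
  · simp only [vertical, Matrix.det_fin_two, Matrix.submatrix_apply, Matrix.of_apply,
      SetLike.mem_coe, RingHom.mem_ker, map_sub, X_mul_X_eq_monomial, multidegreeHom_monomial,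
      multidegree_single_add_single]
    rw [Multiset.pair_comm (g 0), sub_self]

/-- If `s` were alone in its multidegree, its coefficient would survive under `multidegreeHom`,
which kills the ideal. -/
theorem exists_ne_of_mem_doubleDetIdeal {f : MvPolynomial (Var m n r) K}
    (hf : f ∈ doubleDetIdeal K m n r) {s : Var m n r →₀ ℕ} (hs : s ∈ f.support) :
    ∃ t ∈ f.support, t ≠ s ∧ multidegree t = multidegree s := by
  classical
  by_contra! h
  have h0 : multidegreeHom m n r K f = 0 := doubleDetIdeal_le_ker hf
  rw [f.as_sum, map_sum] at h0
  have h1 := congrArg (fun x => x.coeff (multidegree s)) h0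
  simp only [multidegreeHom_monomial, AddMonoidAlgebra.coeff_sum] at h1
  rw [Finsupp.finsetSum_apply, Finset.sum_eq_single s] at h1
  · rw [AddMonoidAlgebra.coeff_single, Finsupp.single_eq_same] at h1
    exact mem_support_iff.1 hs h1
  · intro t ht hts
    rw [AddMonoidAlgebra.coeff_single, Finsupp.single_eq_of_ne (h t ht hts).symm]
  · intro h'
    exact absurd hs h'

theorem exists_isDiag_of_not_isStandard {s : Set (Var m n r)} (h : ¬ IsStandard s) :
    ∃ v ∈ s, ∃ w ∈ s, IsDiag v w := by
  simpa [IsStandard] using h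

theorem single_add_single_le {σ : Type*} {v w : σ} (hvw : v ≠ w) {t : σ →₀ ℕ}
    (hv : v ∈ t.support) (hw : w ∈ t.support) :
    Finsupp.single v 1 + Finsupp.single w 1 ≤ t := by
  classical
  intro u
  have hv' := Finsupp.mem_support_iff.1 hv
  have hw' := Finsupp.mem_support_iff.1 hw
  simp only [Finsupp.add_apply, Finsupp.single_apply]
  split_ifs with h₁ h₂ h₂
  · exact absurd (h₁.trans h₂.symm) hvw
  all_goals subst_vars; omega

theorem IsDiag.ne {v w : Var m n r} (h : IsDiag v w) : v ≠ w := by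
  rintro rfl
  exact not_isDiag_self v h

/-- The standard monomials are the least ones in their multidegrees. -/
theorem IsStandard.le_of_multidegree_eq {ord : MonomialOrder (Var m n r)}
    (hord : IsDiagonal K ord) {s t : Var m n r →₀ ℕ}
    (hs : IsStandard (s.support : Set (Var m n r))) (h : multidegree t = multidegree s) :
    ord.toSyn s ≤ ord.toSyn t := by
  induction hx : ord.toSyn t using WellFoundedLT.induction generalizing t with
  | ind x ih =>
    subst hx
    by_cases ht : IsStandard (t.support : Set (Var m n r))
    · rw [eq_of_multidegree_eq hs ht h.symm]
    · obtain ⟨v, hv, w, hw, hvw⟩ := exists_isDiag_of_not_isStandard ht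
      obtain ⟨b, hb, hb'⟩ := hvw.exists_lt hord
      -- Split off the diagonal and exchange it for the smaller `b`; the multidegree is kept and
      -- well-founded induction applies.
      obtain ⟨c, rfl⟩ := exists_add_of_le (single_add_single_le hvw.ne hv hw)
      have hlt : ord.toSyn (b + c) <
          ord.toSyn (Finsupp.single v 1 + Finsupp.single w 1 + c) := by
        rw [map_add ord.toSyn b, map_add ord.toSyn (_ + _)]
        exact add_lt_add_left hb _
      refine (ih _ hlt ?_ rfl).trans hlt.le
      rw [← h, map_add, map_add, hb']

/-- Another monomial of `f` shares the multidegree of the leading one. It is at most the leading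
one, but at least it if the latter is standard. -/
theorem not_isStandard_degree {ord : MonomialOrder (Var m n r)} (hord : IsDiagonal K ord)
    {f : MvPolynomial (Var m n r) K} (hf : f ∈ doubleDetIdeal K m n r) (h0 : f ≠ 0) :
    ¬ IsStandard ((ord.degree f).support : Set (Var m n r)) := by
  intro hs
  obtain ⟨t, ht, hne, hdeg⟩ := exists_ne_of_mem_doubleDetIdeal hf (ord.degree_mem_support h0)
  exact hne (ord.toSyn.injective
    (le_antisymm (ord.le_degree ht) (hs.le_of_multidegree_eq hord hdeg)))

end Algebra

/-! ### The Stanley-Reisner complex of the initial ideal -/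

/-- The complex of the standard sets of vertices. -/
def standardComplex (m n r : ℕ) : AbstractSimplicialComplex (Var m n r) where
  faces := {F | F.Nonempty ∧ IsStandard (F : Set (Var m n r))}
  isRelLowerSet_faces := fun F hF => ⟨hF.1, fun G hGF hG =>
    ⟨hG, hF.2.mono (Finset.coe_subset.2 hGF)⟩⟩
  singleton_mem := fun v => ⟨Finset.singleton_nonempty v, by simp [IsStandard, not_isDiag_self]⟩

section StanleyReisner

variable {K : Type*} [Field K]

theorem stanleyReisner_injective {σ : Type*} {Δ Δ' : AbstractSimplicialComplex σ}
    (h : stanleyReisnerIdeal K Δ = stanleyReisnerIdeal K Δ') : Δ = Δ' := by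
  classical
  have hprod (F : Finset σ) : (∏ v ∈ F, X v : MvPolynomial σ K) =
      monomial (∑ v ∈ F, Finsupp.single v 1) 1 := by
    rw [monomial_sum_one]
    rfl
  have happ (F : Finset σ) (w : σ) :
      (∑ v ∈ F, Finsupp.single v 1 : σ →₀ ℕ) w = if w ∈ F then 1 else 0 := by
    simp [Finsupp.finsetSum_apply, Finsupp.single_apply]
  -- A squarefree monomial lies in this monomial ideal only if a generator divides it, so its
  -- support contains a non-face.
  have key (Δ : AbstractSimplicialComplex σ) (F : Finset σ) (hF : F.Nonempty) :
      (∏ v ∈ F, X v : MvPolynomial σ K) ∈ stanleyReisnerIdeal K Δ ↔ F ∉ Δ := by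
    refine ⟨fun hmem hFΔ => ?_, fun hFΔ => Ideal.subset_span ⟨F, hF, hFΔ, rfl⟩⟩
    have hset : {p : MvPolynomial σ K | ∃ F : Finset σ, F.Nonempty ∧ F ∉ Δ ∧ p = ∏ v ∈ F, X v} =
        (fun s => monomial s (1 : K)) ''
          ((fun F : Finset σ => ∑ v ∈ F, Finsupp.single v 1) '' {F | F.Nonempty ∧ F ∉ Δ}) := by
      rw [Set.image_image]
      ext p
      simp only [Set.mem_ofPred_eq, Set.mem_image, hprod, and_assoc, @eq_comm _ p]
    rw [stanleyReisnerIdeal, hset, mem_ideal_span_monomial_image, hprod] at hmem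
    obtain ⟨_, ⟨G, ⟨hG, hGΔ⟩, rfl⟩, hle⟩ := hmem (∑ v ∈ F, Finsupp.single v 1)
      (by simp [mem_support_iff])
    refine hGΔ ((Δ.isRelLowerSet_faces hFΔ).2 (fun w hw => ?_) hG)
    have := hle w
    rw [happ, happ, if_pos hw] at this
    by_contra hwF
    simp [hwF] at this
  refine SetLike.ext fun F => ?_
  by_cases hF : F.Nonempty
  · rw [← not_iff_not, ← key Δ F hF, h, key Δ' F hF]
  · exact iff_of_false (fun hm => hF (Δ.isRelLowerSet_faces hm).1)
      fun hm => hF (Δ'.isRelLowerSet_faces hm).1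

/-- Both ideals are generated by the diagonals: each leading term of a nonzero element and each
non-face monomial is divisible by one. -/
theorem initialIdeal_eq_stanleyReisnerIdeal {ord : MonomialOrder (Var m n r)}
    (hord : IsDiagonal K ord) :
    initialIdeal ord (doubleDetIdeal K m n r) =
      stanleyReisnerIdeal K (standardComplex m n r) := by
  classical
  apply le_antisymm
  · refine Ideal.span_le.2 ?_
    rintro _ ⟨f, hf, rfl⟩
    rcases eq_or_ne f 0 with rfl | h0
    · simp
    obtain ⟨v, hv, w, hw, hvw⟩ :=
      exists_isDiag_of_not_isStandard (not_isStandard_degree hord hf h0)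
    have hmem : (X v * X w : MvPolynomial (Var m n r) K) ∈
        stanleyReisnerIdeal K (standardComplex m n r) := by
      refine Ideal.subset_span ⟨{v, w}, by simp, ?_, (Finset.prod_pair hvw.ne).symm⟩
      intro hm
      exact hm.2 v (by simp) w (by simp) hvw
    refine Ideal.mem_of_dvd _ ?_ hmem
    rw [X_mul_X_eq_monomial, MonomialOrder.leadingTerm, monomial_dvd_monomial]
    exact ⟨Or.inr (single_add_single_le hvw.ne hv hw), one_dvd _⟩
  · refine Ideal.span_le.2 ?_
    rintro _ ⟨F, hF, hFΔ, rfl⟩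
    obtain ⟨v, hv, w, hw, hvw⟩ := exists_isDiag_of_not_isStandard fun h => hFΔ ⟨hF, h⟩
    refine Ideal.mem_of_dvd _ ?_ (hvw.X_mul_X_mem_initialIdeal hord)
    rw [← Finset.prod_pair hvw.ne]
    exact Finset.prod_dvd_prod_of_subset _ _ _ (by
      intro u hu
      simp only [Finset.mem_insert, Finset.mem_singleton] at hu
      rcases hu with rfl | rfl
      · exact hv
      · exact hw)

end StanleyReisner

/-! ### Lattice paths and their words -/

theorem isPath_singleton {p a b : ℤ × ℤ} : IsPath [p] a b ↔ p = a ∧ p = b := by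
  simp [IsPath]

theorem isPath_cons_cons {p q a b : ℤ × ℤ} {l : List (ℤ × ℤ)} :
    IsPath (p :: q :: l) a b ↔
      p = a ∧ (q - p = (-1, 0) ∨ q - p = (0, 1)) ∧ IsPath (q :: l) q b := by
  simp only [IsPath, List.head?_cons, Option.some.injEq, List.getLast?_cons_cons,
    List.isChain_cons_cons]
  tauto

theorem IsPath.ne_nil {a b : ℤ × ℤ} {l : List (ℤ × ℤ)} (h : IsPath l a b) : l ≠ [] := by
  rintro rfl
  simp [IsPath] at h

theorem step_left {p q : ℤ × ℤ} (h : q - p = (-1, 0)) : q.1 = p.1 - 1 ∧ q.2 = p.2 := by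
  have h₁ := congrArg Prod.fst h
  have h₂ := congrArg Prod.snd h
  simp only [Prod.fst_sub, Prod.snd_sub] at h₁ h₂
  omega

theorem step_right {p q : ℤ × ℤ} (h : q - p = (0, 1)) : q.1 = p.1 ∧ q.2 = p.2 + 1 := by
  have h₁ := congrArg Prod.fst h
  have h₂ := congrArg Prod.snd h
  simp only [Prod.fst_sub, Prod.snd_sub] at h₁ h₂
  omega

theorem pathWord_left {p q : ℤ × ℤ} (h : q - p = (-1, 0)) (l : List (ℤ × ℤ)) :
    pathWord (p :: q :: l) = Letter.M :: pathWord (q :: l) := by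
  simp [pathWord, h]

theorem pathWord_right {p q : ℤ × ℤ} (h : q - p = (0, 1)) (l : List (ℤ × ℤ)) :
    pathWord (p :: q :: l) = Letter.N :: pathWord (q :: l) := by
  simp [pathWord, h]

theorem not_mem_pathWord (l : List (ℤ × ℤ)) : Letter.R ∉ pathWord l := by
  fun_induction pathWord l with
  | case1 p q l ih =>
    simp only [List.mem_cons, not_or]
    exact ⟨by split_ifs <;> simp, ih⟩
  | case2 => simp

theorem IsPath.counts {a b : ℤ × ℤ} {l : List (ℤ × ℤ)} (h : IsPath l a b) :
    b.1 = a.1 - (pathWord l).count Letter.M ∧ b.2 = a.2 + (pathWord l).count Letter.N ∧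
      (l.length : ℤ) = 1 + (a.1 - b.1) + (b.2 - a.2) := by
  induction l generalizing a with
  | nil => exact absurd rfl h.ne_nil
  | cons p l ih =>
    cases l with
    | nil =>
      obtain ⟨rfl, rfl⟩ := isPath_singleton.1 h
      simp [pathWord]
    | cons q l =>
      obtain ⟨rfl, hs | hs, h'⟩ := isPath_cons_cons.1 h
      · obtain ⟨i₁, i₂, i₃⟩ := ih h'
        have := step_left hs
        rw [pathWord_left hs, List.length_cons]
        simp only [List.count_cons_self, List.count_cons_of_ne (show Letter.M ≠ Letter.N by simp)]
        push_cast at i₃ ⊢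
        omega
      · obtain ⟨i₁, i₂, i₃⟩ := ih h'
        have := step_right hs
        rw [pathWord_right hs, List.length_cons]
        simp only [List.count_cons_self, List.count_cons_of_ne (show Letter.N ≠ Letter.M by simp)]
        push_cast at i₃ ⊢
        omega

theorem IsPath.bounds {a b : ℤ × ℤ} {l : List (ℤ × ℤ)} (h : IsPath l a b) {q : ℤ × ℤ}
    (hq : q ∈ l) : (b.1 ≤ q.1 ∧ q.1 ≤ a.1) ∧ a.2 ≤ q.2 ∧ q.2 ≤ b.2 := by
  induction l generalizing a with
  | nil => simp at hq
  | cons p l ih =>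
    cases l with
    | nil =>
      obtain ⟨rfl, rfl⟩ := isPath_singleton.1 h
      simp only [List.mem_singleton] at hq
      simp [hq]
    | cons p' l =>
      obtain ⟨rfl, hs, h'⟩ := isPath_cons_cons.1 h
      have hb : (b.1 ≤ p'.1) ∧ p'.2 ≤ b.2 := by
        have := h'.counts
        omega
      have hs' : (p'.1 = p.1 - 1 ∧ p'.2 = p.2) ∨ (p'.1 = p.1 ∧ p'.2 = p.2 + 1) :=
        hs.imp step_left step_right
      rcases List.mem_cons.1 hq with rfl | hq
      · omega
      · have := ih h' hq
        omega

/-- The strict order in which a path visits its points. -/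
def Precedes (p q : ℤ × ℤ) : Prop := q.1 ≤ p.1 ∧ p.2 ≤ q.2 ∧ (q.1 < p.1 ∨ p.2 < q.2)

instance : IsTrans (ℤ × ℤ) Precedes where
  trans p q s h h' := by
    simp only [Precedes] at *
    omega

theorem IsPath.pairwise {a b : ℤ × ℤ} {l : List (ℤ × ℤ)} (h : IsPath l a b) :
    l.Pairwise Precedes := by
  refine List.isChain_iff_pairwise.1 (h.2.2.imp fun p q hpq => ?_)
  have := hpq.imp step_left step_right
  simp only [Precedes]
  omega

theorem IsPath.nodup {a b : ℤ × ℤ} {l : List (ℤ × ℤ)} (h : IsPath l a b) : l.Nodup :=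
  h.pairwise.imp fun {p q} hpq => by
    rintro rfl
    simp only [Precedes] at hpq
    omega

theorem IsPath.comparable {a b : ℤ × ℤ} {l : List (ℤ × ℤ)} (h : IsPath l a b) {p q : ℤ × ℤ}
    (hp : p ∈ l) (hq : q ∈ l) : ¬ (p.1 < q.1 ∧ p.2 < q.2) := by
  have hR : l.Pairwise fun x y => ¬ (x.1 < y.1 ∧ x.2 < y.2) ∧ ¬ (y.1 < x.1 ∧ y.2 < x.2) :=
    h.pairwise.imp fun hxy => by
      simp only [Precedes] at hxy
      omega
  have : Std.Symm fun x y : ℤ × ℤ =>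
      ¬ (x.1 < y.1 ∧ x.2 < y.2) ∧ ¬ (y.1 < x.1 ∧ y.2 < x.2) := ⟨fun _ _ h => h.symm⟩
  exact (hR.forall_of_forall (fun x _ => by simp) hp hq).1

/-- A path is the list of its points sorted by the antisymmetric relation `Precedes`, so the point
set determines it. -/
theorem IsPath.eq_of_mem_iff {a b a' b' : ℤ × ℤ} {l l' : List (ℤ × ℤ)} (h : IsPath l a b)
    (h' : IsPath l' a' b') (hmem : ∀ q, q ∈ l ↔ q ∈ l') : l = l' := by
  refine List.Perm.eq_of_pairwise ?_ h.pairwise h'.pairwise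
    ((List.perm_ext_iff_of_nodup h.nodup h'.nodup).2 hmem)
  intro p q _ _ hpq hqp
  simp only [Precedes] at hpq hqp
  omega

theorem IsPath.eq_of_pathWord_eq {a b b' : ℤ × ℤ} {l l' : List (ℤ × ℤ)} (h : IsPath l a b)
    (h' : IsPath l' a b') (hw : pathWord l = pathWord l') : l = l' := by
  induction l generalizing a l' with
  | nil => exact absurd rfl h.ne_nil
  | cons p l ih =>
    match l, l', h, h', hw with
    | [], [], h, h', _ => exact absurd rfl h'.ne_nil
    | [], [p'], h, h', _ => rw [(isPath_singleton.1 h).1, (isPath_singleton.1 h').1]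
    | [], p' :: q' :: l', _, _, hw => simp [pathWord] at hw
    | q :: l, [], _, h', _ => exact absurd rfl h'.ne_nil
    | q :: l, [p'], _, _, hw => simp [pathWord] at hw
    | q :: l, p' :: q' :: l', h, h', hw =>
      obtain ⟨rfl, hs, h₁⟩ := isPath_cons_cons.1 h
      obtain ⟨rfl, hs', h₁'⟩ := isPath_cons_cons.1 h'
      have hq : q = q' ∧ pathWord (q :: l) = pathWord (q' :: l') := by
        rcases hs with hs | hs <;> rcases hs' with hs' | hs'
        · rw [pathWord_left hs, pathWord_left hs', List.cons.injEq] at hw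
          exact ⟨sub_left_injective (hs.trans hs'.symm), hw.2⟩
        · rw [pathWord_left hs, pathWord_right hs', List.cons.injEq] at hw
          exact absurd hw.1 (by simp)
        · rw [pathWord_right hs, pathWord_left hs', List.cons.injEq] at hw
          exact absurd hw.1 (by simp)
        · rw [pathWord_right hs, pathWord_right hs', List.cons.injEq] at hw
          exact ⟨sub_left_injective (hs.trans hs'.symm), hw.2⟩
      obtain ⟨rfl, hw'⟩ := hq
      rw [ih h₁ h₁' hw']

theorem IsPath.cons {a q b : ℤ × ℤ} {l : List (ℤ × ℤ)} (h : IsPath l q b)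
    (hs : q - a = (-1, 0) ∨ q - a = (0, 1)) : IsPath (a :: l) a b := by
  cases l with
  | nil => exact absurd rfl h.ne_nil
  | cons p l =>
    obtain rfl : p = q := by simpa using h.1
    exact isPath_cons_cons.2 ⟨rfl, hs, h⟩

theorem exists_isPath_of_word (w : List Letter) (hw : Letter.R ∉ w) (a : ℤ × ℤ) :
    ∃ l b, IsPath l a b ∧ pathWord l = w := by
  induction w generalizing a with
  | nil => exact ⟨[a], a, isPath_singleton.2 ⟨rfl, rfl⟩, rfl⟩
  | cons x w ih =>
    simp only [List.mem_cons, not_or] at hw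
    have step (d : ℤ × ℤ) (hd : d = (-1, 0) ∨ d = (0, 1)) : ∃ l b, IsPath (a :: (a + d) :: l) a b ∧
        pathWord ((a + d) :: l) = w := by
      obtain ⟨l, b, hl, hlw⟩ := ih hw.2 (a + d)
      cases l with
      | nil => exact absurd rfl hl.ne_nil
      | cons p l =>
        obtain rfl : p = a + d := by simpa using hl.1
        exact ⟨l, b, hl.cons (by simpa using hd), hlw⟩
    cases x with
    | M =>
      obtain ⟨l, b, hl, hlw⟩ := step (-1, 0) (Or.inl rfl)
      exact ⟨_, b, hl, by rw [pathWord_left (by simp), hlw]⟩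
    | N =>
      obtain ⟨l, b, hl, hlw⟩ := step (0, 1) (Or.inr rfl)
      exact ⟨_, b, hl, by rw [pathWord_right (by simp), hlw]⟩
    | R => exact absurd rfl hw.1

/-- A set of pairwise comparable points of a rectangle lies on a path between its corners. -/
theorem exists_isPath_of_comparable (S : Set (ℤ × ℤ)) (a b : ℤ × ℤ) (h₁ : b.1 ≤ a.1)
    (h₂ : a.2 ≤ b.2) (hS : ∀ q ∈ S, (b.1 ≤ q.1 ∧ q.1 ≤ a.1) ∧ a.2 ≤ q.2 ∧ q.2 ≤ b.2)
    (hcomp : ∀ p ∈ S, ∀ q ∈ S, ¬ (p.1 < q.1 ∧ p.2 < q.2)) :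
    ∃ l, IsPath l a b ∧ ∀ q ∈ S, q ∈ l := by
  -- Induction on the number of remaining steps; `a` is dropped from `S` after each.
  induction hd : ((a.1 - b.1) + (b.2 - a.2)).toNat generalizing S a with
  | zero =>
    refine ⟨[a], isPath_singleton.2 ⟨rfl, Prod.ext (by omega) (by omega)⟩, fun q hq => ?_⟩
    have := hS q hq
    rw [List.mem_singleton]
    exact Prod.ext (by omega) (by omega)
  | succ d ih =>
    have step (c : ℤ × ℤ) (hc : c = (-1, 0) ∨ c = (0, 1)) (hb₁ : b.1 ≤ a.1 + c.1)
        (hb₂ : a.2 + c.2 ≤ b.2) (hc' : ∀ q ∈ S, q ≠ a → q.1 ≤ a.1 + c.1 ∧ a.2 + c.2 ≤ q.2) :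
        ∃ l, IsPath l a b ∧ ∀ q ∈ S, q ∈ l := by
      have hc₂ : (c.1 = -1 ∧ c.2 = 0) ∨ (c.1 = 0 ∧ c.2 = 1) := by
        rcases hc with rfl | rfl <;> simp
      obtain ⟨l, hl, hSl⟩ := ih (S \ {a}) (a + c) hb₁ hb₂ (fun q hq => by
          have := hS q hq.1
          have := hc' q hq.1 hq.2
          exact ⟨⟨by omega, this.1⟩, this.2, by omega⟩)
        (fun p hp q hq => hcomp p hp.1 q hq.1) (by
          simp only [Prod.fst_add, Prod.snd_add]
          omega)
      refine ⟨a :: l, hl.cons (by simpa using hc), fun q hq => ?_⟩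
      by_cases hqa : q = a
      · simp [hqa]
      · exact List.mem_cons_of_mem _ (hSl q ⟨hq, hqa⟩)
    -- Leave the row of `a` as soon as no other point of `S` lies in it.
    by_cases hrow : b.1 < a.1 ∧ ∀ q ∈ S, q ≠ a → q.1 < a.1
    · refine step (-1, 0) (Or.inl rfl) ?_ ?_ fun q hq hqa => ?_
      · show b.1 ≤ a.1 + -1
        omega
      · show a.2 + 0 ≤ b.2
        omega
      · have := hrow.2 q hq hqa
        have := hS q hq
        constructor
        · show q.1 ≤ a.1 + -1
          omega
        · show a.2 + 0 ≤ q.2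
          omega
    · have hcol : a.2 < b.2 ∧ ∀ q ∈ S, q ≠ a → a.2 < q.2 := by
        rw [not_and_or] at hrow
        by_cases hab : b.1 < a.1
        · have hex : ∃ q ∈ S, q ≠ a ∧ a.1 ≤ q.1 := by
            simpa [hab] using hrow
          obtain ⟨q, hq, hqa, hle⟩ := hex
          have hqS := hS q hq
          have hlt : a.2 < q.2 := by
            refine lt_of_le_of_ne hqS.2.1 fun h => hqa (Prod.ext (by omega) h.symm)
          -- `q` lies in the row of `a`, strictly to the right. Another point `p` in the column of
          -- `a` would have both coordinates smaller than `q`.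
          refine ⟨by omega, fun p hp hpa => ?_⟩
          have hpS := hS p hp
          refine lt_of_le_of_ne hpS.2.1 fun h => hcomp p hp q hq ⟨?_, by omega⟩
          refine lt_of_le_of_ne (by omega) fun h' => hpa (Prod.ext (by omega) h.symm)
        · refine ⟨by omega, fun p hp hpa => ?_⟩
          have hpS := hS p hp
          exact lt_of_le_of_ne hpS.2.1 fun h => hpa (Prod.ext (by omega) h.symm)
      refine step (0, 1) (Or.inr rfl) ?_ ?_ fun q hq hqa => ?_
      · show b.1 ≤ a.1 + 0
        omega
      · show a.2 + 1 ≤ b.2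
        omega
      · have := hcol.2 q hq hqa
        have := hS q hq
        constructor
        · show q.1 ≤ a.1 + 0
          omega
        · show a.2 + 1 ≤ q.2
          omega

/-! ### Splitting words at the letter `R` -/

theorem count_intercalate (x : Letter) (L : List (List Letter)) (hL : L ≠ []) :
    ([Letter.R].intercalate L).count x =
      (L.map (List.count x)).sum + if x = Letter.R then L.length - 1 else 0 := by
  induction L with
  | nil => exact absurd rfl hL
  | cons l L ih =>
    rcases eq_or_ne L [] with rfl | hL'
    · simp
    · rw [List.intercalate_cons_of_ne_nil hL', List.count_append, List.count_append, ih hL']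
      have := List.length_pos_iff.2 hL'
      rcases eq_or_ne x Letter.R with rfl | hx
      · simp
        omega
      · simp [hx, hx.symm]

theorem exists_eq_intercalate (w : List Letter) :
    ∃ L : List (List Letter), L ≠ [] ∧ (∀ l ∈ L, Letter.R ∉ l) ∧ w = [Letter.R].intercalate L := by
  induction w with
  | nil => exact ⟨[[]], by simp, by simp, by simp⟩
  | cons x w ih =>
    obtain ⟨L, hL, hR, rfl⟩ := ih
    rcases eq_or_ne x Letter.R with rfl | hx
    · refine ⟨[] :: L, by simp, ?_, ?_⟩
      · simpa using hR
      · rw [List.intercalate_cons_of_ne_nil hL]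
        simp
    · cases L with
      | nil => exact absurd rfl hL
      | cons l L =>
        refine ⟨(x :: l) :: L, by simp, ?_, ?_⟩
        · simp only [List.mem_cons, forall_eq_or_imp, not_or] at hR ⊢
          exact ⟨⟨hx.symm, hR.1⟩, hR.2⟩
        · rw [List.intercalate_cons_cons_left]

/-! ### Systems of paths -/

theorem sum_castSucc_sub_succ {r : ℕ} (g : Fin (r + 1) → ℤ) :
    ∑ k : Fin r, (g k.castSucc - g k.succ) = g 0 - g (Fin.last r) := by
  have h := (Fin.sum_univ_succ g).symm.trans (Fin.sum_univ_castSucc g)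
  rw [Finset.sum_sub_distrib]
  linarith

/-- The conditions on `g`, `h` and the paths in the encoding of a facet. -/
structure IsPathSystem (m n : ℕ) {r : ℕ} (g h : Fin (r + 1) → ℤ) (p : Fin r → List (ℤ × ℤ)) :
    Prop where
  antitone_left : Antitone g
  left_zero : g 0 = m
  left_last : g (Fin.last r) = 1
  antitone_right : Antitone h
  right_zero : h 0 = n
  right_last : h (Fin.last r) = 1
  isPath : ∀ k : Fin r, IsPath (p k)
    (g k.castSucc, (k : ℤ) * n + h k.succ) (g k.succ, (k : ℤ) * n + h k.castSucc)

/-- The word of a system of paths. -/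
def systemWord (p : Fin r → List (ℤ × ℤ)) : List Letter :=
  [Letter.R].intercalate (List.ofFn fun k => pathWord (p k))

theorem encodes_iff {F : Finset (Var m n r)} {w : List Letter} :
    Encodes F w ↔ ∃ g h p, IsPathSystem (r := r) m n g h p ∧
      gridPoint '' (F : Set (Var m n r)) = {q | ∃ k, q ∈ p k} ∧ w = systemWord p := by
  constructor
  · rintro ⟨g, h, p, ⟨h₁, h₂, h₃⟩, ⟨h₄, h₅, h₆⟩, h₇, h₈, h₉⟩
    exact ⟨g, h, p, ⟨h₁, h₂, h₃, h₄, h₅, h₆, h₇⟩, h₈, h₉⟩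
  · rintro ⟨g, h, p, ⟨h₁, h₂, h₃, h₄, h₅, h₆, h₇⟩, h₈, h₉⟩
    exact ⟨g, h, p, ⟨h₁, h₂, h₃⟩, ⟨h₄, h₅, h₆⟩, h₇, h₈, h₉⟩

/-- Division by `n` with remainders in `1, ..., n`. -/
theorem block_unique {n : ℕ} {k k' c c' : ℤ} (hc : 1 ≤ c ∧ c ≤ n) (hc' : 1 ≤ c' ∧ c' ≤ n)
    (h : k * n + c = k' * n + c') : k = k' ∧ c = c' := by
  have hk : k = k' := by
    rcases lt_trichotomy k k' with hlt | heq | hlt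
    · nlinarith
    · exact heq
    · nlinarith
  exact ⟨hk, by subst hk; linarith⟩

theorem gridPoint_fst (v : Var m n r) : (gridPoint v).1 = (v.1 : ℤ) + 1 := rfl

theorem gridPoint_snd (v : Var m n r) :
    (gridPoint v).2 = (v.2.2 : ℤ) * n + ((v.2.1 : ℤ) + 1) := rfl

theorem var_bounds (v : Var m n r) :
    (1 ≤ (v.1 : ℤ) + 1 ∧ (v.1 : ℤ) + 1 ≤ m) ∧ 1 ≤ (v.2.1 : ℤ) + 1 ∧ (v.2.1 : ℤ) + 1 ≤ n := by
  have := v.1.2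
  have := v.2.1.2
  omega

theorem gridPoint_injective : Function.Injective (gridPoint : Var m n r → ℤ × ℤ) := by
  intro v w h
  have h₁ := congrArg Prod.fst h
  have h₂ := congrArg Prod.snd h
  rw [gridPoint_fst, gridPoint_fst] at h₁
  rw [gridPoint_snd, gridPoint_snd] at h₂
  obtain ⟨h₃, h₄⟩ := block_unique (var_bounds v).2 (var_bounds w).2 h₂
  refine Prod.ext (Fin.ext (by omega)) (Prod.ext (Fin.ext (by omega)) (Fin.ext (by omega)))

namespace IsPathSystem

variable {g h : Fin (r + 1) → ℤ} {p : Fin r → List (ℤ × ℤ)}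

theorem right_bounds (hs : IsPathSystem m n g h p) (k : Fin (r + 1)) : 1 ≤ h k ∧ h k ≤ n := by
  rw [← hs.right_last, ← hs.right_zero]
  exact ⟨hs.antitone_right (Fin.le_last k), hs.antitone_right (Fin.zero_le k)⟩

theorem left_bounds (hs : IsPathSystem m n g h p) (k : Fin (r + 1)) : 1 ≤ g k ∧ g k ≤ m := by
  rw [← hs.left_last, ← hs.left_zero]
  exact ⟨hs.antitone_left (Fin.le_last k), hs.antitone_left (Fin.zero_le k)⟩

theorem eq_block (hs : IsPathSystem m n g h p) {v : Var m n r} {k : Fin r}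
    (hv : gridPoint v ∈ p k) : v.2.2 = k := by
  have hb := ((hs.isPath k).bounds hv).2
  have h₁ := hs.right_bounds k.succ
  have h₂ := hs.right_bounds k.castSucc
  rw [gridPoint_snd] at hb
  dsimp only at hb
  have := (block_unique (k := v.2.2) (k' := k) (c := (v.2.1 : ℤ) + 1)
    (c' := (v.2.2 : ℤ) * n + ((v.2.1 : ℤ) + 1) - k * n) (n := n) (var_bounds v).2
    ⟨by linarith, by linarith⟩ (by ring)).1
  exact Fin.ext (by omega)

theorem mem_bounds (hs : IsPathSystem m n g h p) {v : Var m n r}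
    (hv : gridPoint v ∈ p v.2.2) :
    (g v.2.2.succ ≤ (v.1 : ℤ) + 1 ∧ (v.1 : ℤ) + 1 ≤ g v.2.2.castSucc) ∧
      h v.2.2.succ ≤ (v.2.1 : ℤ) + 1 ∧ (v.2.1 : ℤ) + 1 ≤ h v.2.2.castSucc := by
  have := (hs.isPath v.2.2).bounds hv
  rw [gridPoint_fst, gridPoint_snd] at this
  dsimp only at this
  refine ⟨this.1, ?_, ?_⟩ <;> linarith [this.2.1, this.2.2]

theorem exists_gridPoint (hs : IsPathSystem m n g h p) {k : Fin r} {q : ℤ × ℤ} (hq : q ∈ p k) :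
    ∃ v : Var m n r, gridPoint v = q := by
  have hb := (hs.isPath k).bounds hq
  have h₁ := hs.right_bounds k.succ
  have h₂ := hs.right_bounds k.castSucc
  have h₃ := hs.left_bounds k.succ
  have h₄ := hs.left_bounds k.castSucc
  dsimp only at hb
  obtain ⟨a, ha⟩ := Int.eq_ofNat_of_zero_le (show 0 ≤ q.1 - 1 by omega)
  obtain ⟨b, hb'⟩ := Int.eq_ofNat_of_zero_le (show 0 ≤ q.2 - k * n - 1 by linarith)
  refine ⟨(⟨a, by omega⟩, ⟨b, ?_⟩, k), Prod.ext ?_ ?_⟩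
  · have : (b : ℤ) + 1 ≤ n := by linarith
    omega
  · simp only [gridPoint]
    linarith
  · simp only [gridPoint]
    linarith

theorem mem_iff (hs : IsPathSystem m n g h p) {F : Finset (Var m n r)}
    (hF : gridPoint '' (F : Set (Var m n r)) = {q | ∃ k, q ∈ p k}) (v : Var m n r) :
    v ∈ F ↔ gridPoint v ∈ p v.2.2 := by
  rw [← Finset.mem_coe, ← gridPoint_injective.mem_set_image, hF]
  constructor
  · rintro ⟨k, hk⟩
    rwa [hs.eq_block hk]
  · exact fun h => ⟨_, h⟩

theorem exists_finset (hs : IsPathSystem m n g h p) :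
    ∃ F : Finset (Var m n r), gridPoint '' (F : Set (Var m n r)) = {q | ∃ k, q ∈ p k} := by
  classical
  refine ⟨Finset.univ.filter fun v => ∃ k, gridPoint v ∈ p k, ?_⟩
  ext q
  simp only [Finset.coe_filter, Finset.mem_univ, true_and, Set.mem_image, Set.mem_ofPred_eq]
  constructor
  · rintro ⟨v, hv, rfl⟩
    exact hv
  · rintro ⟨k, hk⟩
    obtain ⟨v, rfl⟩ := hs.exists_gridPoint hk
    exact ⟨v, ⟨k, hk⟩, rfl⟩

theorem counts (hs : IsPathSystem m n g h p) (hr : 1 ≤ r) :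
    (systemWord p).count Letter.M = m - 1 ∧ (systemWord p).count Letter.N = n - 1 ∧
      (systemWord p).count Letter.R = r - 1 := by
  have hne : (List.ofFn fun k => pathWord (p k)) ≠ [] := by
    rw [← List.length_pos_iff, List.length_ofFn]
    exact hr
  have hsum (x : Letter) : ((List.ofFn fun k => pathWord (p k)).map (List.count x)).sum =
      ∑ k, (pathWord (p k)).count x := by
    rw [List.map_ofFn, List.sum_ofFn]
    rfl
  have hg := sum_castSucc_sub_succ g
  have hh := sum_castSucc_sub_succ h
  rw [hs.left_zero, hs.left_last] at hg
  rw [hs.right_zero, hs.right_last] at hh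
  refine ⟨?_, ?_, ?_⟩
  · rw [systemWord, count_intercalate _ _ hne, hsum]
    have : ((∑ k, (pathWord (p k)).count Letter.M : ℕ) : ℤ) = m - 1 := by
      rw [← hg]
      push_cast
      refine Finset.sum_congr rfl fun k _ => ?_
      have := (hs.isPath k).counts.1
      dsimp only at this
      linarith
    simp
    omega
  · rw [systemWord, count_intercalate _ _ hne, hsum]
    have : ((∑ k, (pathWord (p k)).count Letter.N : ℕ) : ℤ) = n - 1 := by
      rw [← hh]
      push_cast
      refine Finset.sum_congr rfl fun k _ => ?_
      have := (hs.isPath k).counts.2.1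
      dsimp only at this
      linarith
    simp
    omega
  · rw [systemWord, count_intercalate _ _ hne, hsum]
    simp [List.count_eq_zero.2 (not_mem_pathWord _)]

theorem isStandard (hs : IsPathSystem m n g h p) {F : Finset (Var m n r)}
    (hF : gridPoint '' (F : Set (Var m n r)) = {q | ∃ k, q ∈ p k}) :
    IsStandard (F : Set (Var m n r)) := by
  intro v hv w hw hvw
  rw [Finset.mem_coe, hs.mem_iff hF] at hv hw
  have bv := hs.mem_bounds hv
  have bw := hs.mem_bounds hw
  by_cases hk : v.2.2 = w.2.2
  · have := (hs.isPath _).comparable hv (hk ▸ hw)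
    rw [gridPoint_fst, gridPoint_fst, gridPoint_snd, gridPoint_snd, hk] at this
    simp only [IsDiag, hk, lt_irrefl, true_and, false_or, Fin.lt_def] at hvw
    refine this ⟨by omega, ?_⟩
    have : (v.2.1 : ℤ) < w.2.1 := by omega
    linarith
  · have hlt : v.2.2 < w.2.2 := by
      simp only [IsDiag, hk, false_and, or_false] at hvw
      tauto
    -- The rectangle of the later block starts at or beyond the corner where the earlier one ends,
    -- so neither index can increase.
    have hle : v.2.2.succ ≤ w.2.2.castSucc := Fin.succ_le_castSucc_iff.2 hlt
    have := hs.antitone_left hle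
    have := hs.antitone_right hle
    simp only [IsDiag, hk, false_and, or_false, Fin.lt_def] at hvw
    omega

/-- Paths in different blocks are disjoint, and each has one point more than its number of steps;
the step counts telescope. -/
theorem card (hs : IsPathSystem m n g h p) {F : Finset (Var m n r)}
    (hF : gridPoint '' (F : Set (Var m n r)) = {q | ∃ k, q ∈ p k}) :
    (F.card : ℤ) = r + (m - 1) + (n - 1) := by
  classical
  have hfib (k : Fin r) : (F.filter fun v => v.2.2 = k).card = (p k).length := by
    rw [← List.toFinset_card_of_nodup (hs.isPath k).nodup,
      ← Finset.card_image_of_injective _ gridPoint_injective]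
    congr 1
    ext q
    simp only [Finset.mem_image, Finset.mem_filter, List.mem_toFinset, hs.mem_iff hF]
    constructor
    · rintro ⟨v, ⟨hv, rfl⟩, rfl⟩
      exact hv
    · intro hq
      obtain ⟨v, rfl⟩ := hs.exists_gridPoint hq
      have := hs.eq_block hq
      exact ⟨v, ⟨this ▸ hq, this⟩, rfl⟩
  rw [Finset.card_eq_sum_card_fiberwise (f := fun v => v.2.2) (t := Finset.univ)
    (fun _ _ => Finset.mem_coe.2 (Finset.mem_univ _))]
  have hg := sum_castSucc_sub_succ g
  have hh := sum_castSucc_sub_succ h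
  rw [hs.left_zero, hs.left_last] at hg
  rw [hs.right_zero, hs.right_last] at hh
  rw [← hg, ← hh]
  have hlen (k : Fin r) : ((p k).length : ℤ) =
      1 + (g k.castSucc - g k.succ) + (h k.castSucc - h k.succ) := by
    have := (hs.isPath k).counts.2.2
    dsimp only at this
    linarith
  push_cast
  simp only [hfib, hlen, Finset.sum_add_distrib]
  simp

theorem paths_eq_of_systemWord_eq (hs : IsPathSystem m n g h p) (hr : 1 ≤ r)
    {g' h' : Fin (r + 1) → ℤ} {p' : Fin r → List (ℤ × ℤ)} (hs' : IsPathSystem m n g' h' p')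
    (hw : systemWord p = systemWord p') : p = p' := by
  have hsplit (p : Fin r → List (ℤ × ℤ)) :
      (systemWord p).splitOn Letter.R = List.ofFn fun k => pathWord (p k) := by
    refine List.splitOn_intercalate _ ?_ ?_
    · intro l hl
      obtain ⟨k, rfl⟩ := (List.mem_ofFn' _ _).1 hl
      exact not_mem_pathWord _
    · rw [← List.length_pos_iff, List.length_ofFn]
      exact hr
  have hword (k : Fin r) : pathWord (p k) = pathWord (p' k) :=
    congrFun (List.ofFn_injective ((hsplit p).symm.trans ((congrArg _ hw).trans (hsplit p')))) k
  -- The starting values are fixed, and the counts of `M` and `N` in the `k`-th piece give the next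
  -- corner values.
  have hgh (k : Fin (r + 1)) : g k = g' k ∧ h k = h' k := by
    induction k using Fin.induction with
    | zero =>
      exact ⟨hs.left_zero.trans hs'.left_zero.symm, hs.right_zero.trans hs'.right_zero.symm⟩
    | succ k ih =>
      have h₁ := (hs.isPath k).counts
      have h₂ := (hs'.isPath k).counts
      rw [hword k] at h₁
      dsimp only at h₁ h₂
      exact ⟨by linarith [h₁.1, h₂.1, ih.1], by linarith [h₁.2.1, h₂.2.1, ih.2]⟩
  funext k
  have h₁ := hs.isPath k
  rw [(hgh k.castSucc).1, (hgh k.succ).2] at h₁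
  exact h₁.eq_of_pathWord_eq (hs'.isPath k) (hword k)

end IsPathSystem

theorem exists_isPathSystem_of_word (hr : 1 ≤ r) {w : List Letter} (hM : w.count Letter.M + 1 = m)
    (hN : w.count Letter.N + 1 = n) (hR : w.count Letter.R + 1 = r) :
    ∃ g h p, IsPathSystem (r := r) m n g h p ∧ w = systemWord p := by
  obtain ⟨L, hL, hLR, rfl⟩ := exists_eq_intercalate w
  have hsum : (L.map (List.count Letter.R)).sum = 0 := by
    refine List.sum_eq_zero fun x hx => ?_
    obtain ⟨l, hl, rfl⟩ := List.mem_map.1 hx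
    exact List.count_eq_zero.2 (hLR l hl)
  have hlen : L.length = r := by
    have := List.length_pos_iff.2 hL
    rw [count_intercalate _ _ hL, hsum, if_pos rfl] at hR
    omega
  subst hlen
  have hcount (x : Letter) (hx : x ≠ Letter.R) : ([Letter.R].intercalate L).count x =
      ∑ k : Fin L.length, L[k].count x := by
    rw [count_intercalate _ _ hL, if_neg hx, add_zero]
    conv_lhs => rw [← List.ofFn_get L, List.map_ofFn, List.sum_ofFn]
    rfl
  rw [hcount _ (by simp)] at hM hN
  -- The corner sequence descends from `c` by the letter counts; their total is `c - 1`, so it ends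
  -- at 1.
  have cut (c : ℕ) (f : Fin L.length → ℕ) (hf : ∑ k, f k + 1 = c) :
      ∃ g : Fin (L.length + 1) → ℤ, Antitone g ∧ g 0 = c ∧ g (Fin.last _) = 1 ∧
        ∀ k, g k.succ = g k.castSucc - f k := by
    set g : Fin (L.length + 1) → ℤ := fun k => c - Fin.partialSum (fun k => (f k : ℤ)) k with hg
    have hstep (k) : g k.succ = g k.castSucc - f k := by
      simp only [hg, Fin.partialSum_succ]
      ring
    have h0 : g 0 = c := by simp [hg]
    refine ⟨g, Fin.antitone_iff_succ_le.2 fun k => ?_, h0, ?_, hstep⟩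
    · rw [hstep]
      omega
    · have := sum_castSucc_sub_succ g
      simp only [hstep, sub_sub_cancel, h0] at this
      rw [← hf] at this
      push_cast at this
      linarith
  obtain ⟨g, hg, hg0, hg1, hgs⟩ := cut m _ hM
  obtain ⟨h, hh, hh0, hh1, hhs⟩ := cut n _ hN
  choose p b hp hpw using fun k : Fin L.length => exists_isPath_of_word L[k]
    (hLR _ (List.getElem_mem _)) (g k.castSucc, (k : ℤ) * n + h k.succ)
  refine ⟨g, h, p, ⟨hg, hg0, hg1, hh, hh0, hh1, fun k => ?_⟩, ?_⟩
  · have hb : b k = (g k.succ, (k : ℤ) * n + h k.castSucc) := by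
      have hc := (hp k).counts
      rw [hpw] at hc
      dsimp only at hc
      refine Prod.ext ?_ ?_
      · rw [hc.1, hgs]
      · rw [hc.2.1, hhs]
        dsimp only
        ring
    exact hb ▸ hp k
  · rw [systemWord]
    simp only [hpw]
    congr 1
    exact (List.ofFn_get L).symm

/-! ### Path systems through a standard set -/

theorem exists_cut (hr : 1 ≤ r) (S : Finset (Var m n r)) (f : Var m n r → ℤ) {c : ℤ} (hc : 1 ≤ c)
    (hf : ∀ v, 1 ≤ f v ∧ f v ≤ c)
    (hS : ∀ v ∈ S, ∀ w ∈ S, v.2.2 < w.2.2 → f w ≤ f v) :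
    ∃ g : Fin (r + 1) → ℤ, Antitone g ∧ g 0 = c ∧ g (Fin.last r) = 1 ∧
      ∀ v ∈ S, g v.2.2.succ ≤ f v ∧ f v ≤ g v.2.2.castSucc := by
  classical
  -- The cut `g k` is the least value of `f` on the blocks before position `k`. Inserting `c` gives
  -- `g 0 = c` and keeps the minimum defined; the last cut is set to 1 separately.
  set T : Fin (r + 1) → Finset ℤ := fun k =>
    insert c ((S.filter fun v => v.2.2.castSucc < k).image f) with hT
  have hne (k) : (T k).Nonempty := Finset.insert_nonempty _ _
  have hmem (k) {x : ℤ} : x ∈ T k ↔ x = c ∨ ∃ v ∈ S, v.2.2.castSucc < k ∧ f v = x := by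
    simp [hT, and_assoc]
  set g : Fin (r + 1) → ℤ := fun k => if k = Fin.last r then 1 else (T k).min' (hne k) with hg
  have hpos (k) : 1 ≤ (T k).min' (hne k) := by
    rcases (hmem k).1 (Finset.min'_mem _ (hne k)) with h | ⟨v, -, -, h⟩
    · exact h ▸ hc
    · exact h ▸ (hf v).1
  refine ⟨g, fun k l hkl => ?_, ?_, by simp [hg], fun v hv => ⟨?_, ?_⟩⟩
  · simp only [hg]
    split_ifs with h₁ h₂ h₂
    · exact le_rfl
    · exact hpos k
    · exact absurd (Fin.last_le_iff.1 (h₂ ▸ hkl)) h₁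
    · refine Finset.min'_subset _ fun x hx => ?_
      rw [hmem] at hx ⊢
      exact hx.imp_right fun ⟨v, hv, hvk, h⟩ => ⟨v, hv, hvk.trans_le hkl, h⟩
  · have h0 : (0 : Fin (r + 1)) ≠ Fin.last r := by
      simp only [ne_eq, Fin.ext_iff, Fin.val_zero, Fin.val_last]
      omega
    simp only [hg, if_neg h0]
    rcases (hmem 0).1 (Finset.min'_mem _ (hne 0)) with h | ⟨v, -, h, -⟩
    · exact h
    · exact absurd h (Fin.not_lt_zero _)
  · simp only [hg]
    split_ifs
    · exact (hf v).1
    · exact Finset.min'_le _ _ ((hmem _).2 (Or.inr ⟨v, hv, Fin.castSucc_lt_succ, rfl⟩))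
  · simp only [hg, if_neg (Fin.castSucc_lt_last v.2.2).ne]
    rcases (hmem _).1 (Finset.min'_mem _ (hne v.2.2.castSucc)) with h | ⟨w, hw, hwv, h⟩
    · rw [h]
      exact (hf v).2
    · rw [← h]
      exact hS w hw v hv (Fin.castSucc_lt_castSucc_iff.1 hwv)

theorem exists_isPathSystem_of_isStandard (hm : 1 ≤ m) (hn : 1 ≤ n) (hr : 1 ≤ r)
    {S : Finset (Var m n r)} (hS : IsStandard (S : Set (Var m n r))) :
    ∃ g h p, IsPathSystem m n g h p ∧ ∀ v ∈ S, gridPoint v ∈ p v.2.2 := by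
  obtain ⟨g, hg, hg0, hg1, hgS⟩ := exists_cut hr S (fun v => (v.1 : ℤ) + 1)
    (c := m) (by omega) (fun v => (var_bounds v).1) fun v hv w hw hvw => by
      have := Fin.le_def.1 (hS.fst_le hv hw hvw)
      omega
  obtain ⟨h, hh, hh0, hh1, hhS⟩ := exists_cut hr S (fun v => (v.2.1 : ℤ) + 1)
    (c := n) (by omega) (fun v => (var_bounds v).2) fun v hv w hw hvw => by
      have := Fin.le_def.1 (hS.snd_le hv hw hvw)
      omega
  have hpath (k : Fin r) := exists_isPath_of_comparable
    (gridPoint '' {v | v ∈ S ∧ v.2.2 = k}) (g k.castSucc, (k : ℤ) * n + h k.succ)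
    (g k.succ, (k : ℤ) * n + h k.castSucc) (hg (Fin.castSucc_lt_succ).le)
    (by simpa using hh (Fin.castSucc_lt_succ (i := k)).le)
    (by
      rintro _ ⟨v, ⟨hv, rfl⟩, rfl⟩
      rw [gridPoint_fst, gridPoint_snd]
      exact ⟨hgS v hv, by simpa using (hhS v hv).1, by simpa using (hhS v hv).2⟩)
    (by
      rintro _ ⟨v, ⟨hv, rfl⟩, rfl⟩ _ ⟨w, ⟨hw, hvw⟩, rfl⟩
      rw [gridPoint_fst, gridPoint_snd, gridPoint_fst, gridPoint_snd, hvw]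
      rintro ⟨h₁, h₂⟩
      -- Points of one block increasing in both coordinates would form a diagonal of H.
      refine hS v hv w hw (Or.inl ⟨Fin.lt_def.2 (by omega), Or.inr ⟨hvw.symm, ?_⟩⟩)
      exact Fin.lt_def.2 (by omega))
  choose p hp hpS using hpath
  exact ⟨g, h, p, ⟨hg, hg0, hg1, hh, hh0, hh1, hp⟩,
    fun v hv => hpS _ _ ⟨v, ⟨hv, rfl⟩, rfl⟩⟩

/-! ### Facets and words -/

theorem Encodes.counts (hr : 1 ≤ r) {F : Finset (Var m n r)} {w : List Letter}
    (h : Encodes F w) :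
    w.count Letter.M = m - 1 ∧ w.count Letter.N = n - 1 ∧ w.count Letter.R = r - 1 := by
  obtain ⟨g, h, p, hs, -, rfl⟩ := encodes_iff.1 h
  exact hs.counts hr

theorem Encodes.isStandard {F : Finset (Var m n r)} {w : List Letter} (h : Encodes F w) :
    IsStandard (F : Set (Var m n r)) := by
  obtain ⟨g, h, p, hs, hF, -⟩ := encodes_iff.1 h
  exact hs.isStandard hF

theorem Encodes.card_eq {F F' : Finset (Var m n r)} {w w' : List Letter} (h : Encodes F w)
    (h' : Encodes F' w') : F.card = F'.card := by
  obtain ⟨_, _, _, hs, hF, -⟩ := encodes_iff.1 h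
  obtain ⟨_, _, _, hs', hF', -⟩ := encodes_iff.1 h'
  exact_mod_cast (hs.card hF).trans (hs'.card hF').symm

theorem Encodes.nonempty (hm : 1 ≤ m) (hn : 1 ≤ n) (hr : 1 ≤ r) {F : Finset (Var m n r)}
    {w : List Letter} (h : Encodes F w) : F.Nonempty := by
  obtain ⟨_, _, _, hs, hF, -⟩ := encodes_iff.1 h
  have := hs.card hF
  exact Finset.card_pos.1 (by omega)

theorem Encodes.eq_of_word_eq (hr : 1 ≤ r) {F F' : Finset (Var m n r)} {w : List Letter}
    (h : Encodes F w) (h' : Encodes F' w) : F = F' := by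
  obtain ⟨_, _, p, hs, hF, rfl⟩ := encodes_iff.1 h
  obtain ⟨_, _, p', hs', hF', hw⟩ := encodes_iff.1 h'
  obtain rfl := hs.paths_eq_of_systemWord_eq hr hs' hw
  ext v
  rw [hs.mem_iff hF, hs'.mem_iff hF']

theorem Encodes.word_unique {F : Finset (Var m n r)} {w w' : List Letter}
    (h : Encodes F w) (h' : Encodes F w') : w = w' := by
  obtain ⟨_, _, p, hs, hF, rfl⟩ := encodes_iff.1 h
  obtain ⟨_, _, p', hs', hF', rfl⟩ := encodes_iff.1 h'
  congr 1
  funext k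
  refine (hs.isPath k).eq_of_mem_iff (hs'.isPath k) fun q => ⟨fun hq => ?_, fun hq => ?_⟩
  · obtain ⟨v, rfl⟩ := hs.exists_gridPoint hq
    obtain rfl := hs.eq_block hq
    exact (hs'.mem_iff hF' v).1 ((hs.mem_iff hF v).2 hq)
  · obtain ⟨v, rfl⟩ := hs'.exists_gridPoint hq
    obtain rfl := hs'.eq_block hq
    exact (hs.mem_iff hF v).1 ((hs'.mem_iff hF' v).2 hq)

theorem exists_encodes_of_word (hm : 1 ≤ m) (hn : 1 ≤ n) (hr : 1 ≤ r) (w : Words m n r) :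
    ∃ F : Finset (Var m n r), Encodes F w.1 := by
  obtain ⟨w, h₁, h₂, h₃⟩ := w
  obtain ⟨g, h, p, hs, hw⟩ := exists_isPathSystem_of_word (m := m) (n := n) hr (w := w)
    (by omega) (by omega) (by omega)
  obtain ⟨F, hF⟩ := hs.exists_finset
  exact ⟨F, encodes_iff.2 ⟨g, h, p, hs, hF, hw⟩⟩

theorem exists_encodes_of_isStandard (hm : 1 ≤ m) (hn : 1 ≤ n) (hr : 1 ≤ r)
    {S : Finset (Var m n r)} (hS : IsStandard (S : Set (Var m n r))) :
    ∃ (F : Finset (Var m n r)) (w : List Letter), S ⊆ F ∧ Encodes F w := by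
  obtain ⟨g, h, p, hs, hSp⟩ := exists_isPathSystem_of_isStandard hm hn hr hS
  obtain ⟨F, hF⟩ := hs.exists_finset
  exact ⟨F, _, fun v hv => (hs.mem_iff hF v).2 (hSp v hv), encodes_iff.2 ⟨g, h, p, hs, hF, rfl⟩⟩

/-- Every standard set lies in an encoded one, and encoded sets are standard of equal size, so none
contains another properly. -/
theorem maximal_iff_exists_encodes (hm : 1 ≤ m) (hn : 1 ≤ n) (hr : 1 ≤ r)
    {F : Finset (Var m n r)} :
    Maximal (fun G => G ∈ standardComplex m n r) F ↔ ∃ w, Encodes F w := by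
  constructor
  · rintro ⟨hF, hmax⟩
    obtain ⟨G, w, hFG, hG⟩ := exists_encodes_of_isStandard hm hn hr hF.2
    obtain rfl : F = G := le_antisymm hFG (hmax ⟨hG.nonempty hm hn hr, hG.isStandard⟩ hFG)
    exact ⟨w, hG⟩
  · rintro ⟨w, hF⟩
    refine ⟨⟨hF.nonempty hm hn hr, hF.isStandard⟩, fun G hG hFG => ?_⟩
    obtain ⟨G', w', hGG', hG'⟩ := exists_encodes_of_isStandard hm hn hr hG.2
    rw [Finset.eq_of_subset_of_card_le (hFG.trans hGG') (hG'.card_eq hF).le]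
    exact hGG'

theorem exists_facets_equiv_words (hm : 1 ≤ m) (hn : 1 ≤ n) (hr : 1 ≤ r) :
    ∃ e : Facets (standardComplex m n r) ≃ Words m n r, ∀ F w, e F = w ↔ Encodes F.1 w.1 := by
  have hex (F : Facets (standardComplex m n r)) : ∃ w : Words m n r, Encodes F.1 w.1 := by
    obtain ⟨w, hw⟩ := (maximal_iff_exists_encodes hm hn hr).1 F.2
    exact ⟨⟨w, hw.counts hr⟩, hw⟩
  choose e he using hex
  have hinj : Function.Injective e := fun F G h =>
    Subtype.val_injective ((he F).eq_of_word_eq hr (h ▸ he G))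
  have hsurj : Function.Surjective e := fun w => by
    obtain ⟨F, hF⟩ := exists_encodes_of_word hm hn hr w
    refine ⟨⟨F, (maximal_iff_exists_encodes hm hn hr).2 ⟨_, hF⟩⟩, Subtype.val_injective ?_⟩
    exact Encodes.word_unique (he _) hF
  have hbij : Function.Bijective e := ⟨hinj, hsurj⟩
  refine ⟨Equiv.ofBijective e hbij, fun F w => ?_⟩
  rw [Equiv.ofBijective_apply]
  exact ⟨fun h => h ▸ he F, fun h => Subtype.val_injective ((he F).word_unique h)⟩

end DoubleDet

theorem mainTheorem10 {K : Type*} [Field K] (m n r : ℕ) (hm : 1 ≤ m) (hn : 1 ≤ n) (hr : 1 ≤ r)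
    (ord : MonomialOrder (DoubleDet.Var m n r)) (hord : DoubleDet.IsDiagonal K ord) :
    (∃! Δ : AbstractSimplicialComplex (DoubleDet.Var m n r),
      DoubleDet.initialIdeal ord (DoubleDet.doubleDetIdeal K m n r) =
        DoubleDet.stanleyReisnerIdeal K Δ) ∧
    ∀ Δ : AbstractSimplicialComplex (DoubleDet.Var m n r),
      DoubleDet.initialIdeal ord (DoubleDet.doubleDetIdeal K m n r) =
        DoubleDet.stanleyReisnerIdeal K Δ →
      ∃ e : DoubleDet.Facets Δ ≃ DoubleDet.Words m n r,
        ∀ (F : DoubleDet.Facets Δ) (w : DoubleDet.Words m n r),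
          e F = w ↔ DoubleDet.Encodes F.1 w.1 := by
  have hinit := DoubleDet.initialIdeal_eq_stanleyReisnerIdeal hord
  refine ⟨⟨_, hinit, fun Δ hΔ => DoubleDet.stanleyReisner_injective (hΔ.symm.trans hinit)⟩,
    fun Δ hΔ => ?_⟩
  obtain rfl := DoubleDet.stanleyReisner_injective (hΔ.symm.trans hinit)
  exact DoubleDet.exists_facets_equiv_words hm hn hr
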